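/- Let $N\ge 1$. In the beta-Bernoulli bandit alignment problem with $N$ arms, the action set is $\mathcal A=\mathcal A_e\cup\mathcal A_h$ with environment actions $\mathcal A_e=\{1,\dots,N\}$ and human queries $\mathcal A_h=\{\bar 1,\dots,\bar N\}$ (so $|\mathcal A|=2N$), and observations lie in $\{0,1\}$. The unknown parameters $\phi=(\phi_a)_{a\in\mathcal A_e}$ and $\theta=(\theta_{\bar a})_{\bar a\in\mathcal A_h}$ consist of $2N$ mutually independent $\mathrm{beta}(1,1)$ random variables. At each time $t=0,1,2,\dots$ an agent $\pi$ draws an action $A_t\sim\pi(\cdot\mid H_t)$, where $H_t=(A_0,O_1,\dots,A_{t-1},O_t)$ is the history and, given $H_t$, $A_t$ is independent of $(\phi,\theta)$; then, given $(H_t,A_t,\phi,\theta)$, it observes $O_{t+1}\sim\mathrm{Bernoulli}(\phi_a)$ if $A_t=a\in\mathcal A_e$ and $O_{t+1}\sim\mathrm{Bernoulli}(\theta_{\bar a})$ if $A_t=\bar a\in\mathcal A_h$. The (unobserved) reward is $R_{t+1}=\mathcal R(A_t,O_{t+1},\theta)$, where $\mathcal R(\bar a,o,\theta)=-1$ for $\bar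 a\in\mathcal A_h$ and $\mathcal R(a,o,\theta)=o\,\theta_{\bar a}+(1-o)(1-\theta_{\bar a})$ for $a\in\mathcal A_e$. Let $R^*=\max_{a\in\mathcal A}\mathbb E[\mathcal R(A_t,O_{t+1},\theta)\mid\phi,\theta,A_t=a]$. The conditional information ratio of $\pi$ at time $t$ is the random variable $$\Gamma_t(\pi)=\frac{\mathbb E_\pi[R^*-R_{t+1}\mid H_t]^2}{\mathbb I(\theta,\phi;A_t,O_{t+1}\mid H_t=H_t)},$$ where $A_t\sim\pi(\cdot\mid H_t)$ and the denominator is the mutual information (in nats) under the conditional law given the realized value of $H_t$. An agent $\pi_{\mathrm{ids}}$ is an information-directed sampling (IDS) agent if, for every $t$ and every history $H_t$ that it reaches with positive probability, $\pi_{\mathrm{ids}}(\cdot\mid H_t)$ minimizes $\Gamma_t(\nu)$ over all probability mass functions $\nu$ on $\mathcal A$ (with $A_t\sim\nu$). Then every IDS agent satisfies, for all integers $T\ge 0$, $$\sum_{t=0}^{T-1}\mathbb E_{\pi_{\mathrm{ids}}}\left[\Gamma_t(\pi_{\mathrm{ids}})\right]\ \le\ 33\sqrt{|\mathcal A|\,T^3}.$$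 -/

import Mathlib

open MeasureTheory ProbabilityTheory
open scoped ENNReal

namespace BanditAlignment

/-- The action set `𝒜 = 𝒜ₑ ∪ 𝒜ₕ` with `N` arms: `Sum.inl a` is the environment action `a`, and
`Sum.inr a` is the associated human query `ā`. -/
abbrev Action (N : ℕ) := Fin N ⊕ Fin N

/-- The observation set `{0, 1}` (`true` stands for `1`, `false` for `0`). -/
abbrev Obs := Bool

/-- The values of the unknown pair `(φ, θ)`: the environment parameters `φ`, and the human
preference parameters `θ`, where `θ a` is the parameter attached to the query `ā`. -/
abbrev Param (N : ℕ) := (Fin N → ℝ) × (Fin N → ℝ)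

/-- Histories `H_t = (A_0, O_1, …, A_{t-1}, O_t)`. -/
abbrev History (N t : ℕ) := Fin t → Action N × Obs

/-- An agent maps every history to a probability mass function on the actions. -/
abbrev Agent (N : ℕ) := ∀ t : ℕ, History N t → PMF (Action N)

/-- The prior: all the `φ a` and all the `θ a` are independent with law `beta(1, 1)`. -/
noncomputable def prior (N : ℕ) : Measure (Param N) :=
  (Measure.pi fun _ : Fin N => betaMeasure 1 1).prod
    (Measure.pi fun _ : Fin N => betaMeasure 1 1)

/-- The Bernoulli parameter of the observation that follows an action. -/
def successProb {N : ℕ} (p : Param N) : Action N → ℝ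
  | Sum.inl a => p.1 a
  | Sum.inr a => p.2 a

/-- The observation probabilities `ρ_φ(o | a)` (for `a ∈ 𝒜ₑ`) and `ρ_θ(o | a)` (for `a ∈ 𝒜ₕ`). -/
noncomputable def obsProb {N : ℕ} (p : Param N) (a : Action N) (o : Obs) : ℝ :=
  if o then successProb p a else 1 - successProb p a

/-- The reward function `𝓡(a, o, θ)`. -/
noncomputable def reward {N : ℕ} (p : Param N) : Action N → Obs → ℝ
  | Sum.inl a, o => if o then p.2 a else 1 - p.2 a
  | Sum.inr _, _ => -1

/-- The conditional mean reward `𝔼[𝓡(A_t, O_{t+1}, θ) | φ, θ, A_t = a]`. -/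
noncomputable def meanReward {N : ℕ} (p : Param N) (a : Action N) : ℝ :=
  ∑ o : Obs, obsProb p a o * reward p a o

/-- The optimal reward `R* = max_a 𝔼[𝓡(A_t, O_{t+1}, θ) | φ, θ, A_t = a]`. -/
noncomputable def optReward {N : ℕ} (p : Param N) : ℝ :=
  ⨆ a : Action N, meanReward p a

/-- The law of `((φ, θ), (A, O))` when `(φ, θ)` has law `μ`, the action `A` is drawn from `ν`
independently of `(φ, θ)`, and then `O` is drawn from the observation probabilities of `A`. -/
noncomputable def stepLaw {N : ℕ} (μ : Measure (Param N)) (ν : PMF (Action N)) :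
    Measure (Param N × (Action N × Obs)) :=
  ∑ x : Action N × Obs,
    (μ.withDensity fun p => ν x.1 * ENNReal.ofReal (obsProb p x.1 x.2)).map fun p => (p, x)

/-- Mutual information (in nats) between the two coordinates of a pair with joint law `J`. -/
noncomputable def mutualInfo {X Y : Type*} [MeasurableSpace X] [MeasurableSpace Y]
    (J : Measure (X × Y)) : ℝ≥0∞ :=
  InformationTheory.klDiv J ((J.map Prod.fst).prod (J.map Prod.snd))

/-- The information ratio `(𝔼[R* - 𝓡(A, O, θ)])² / 𝕀(φ, θ; A, O)` when `((φ, θ), (A, O))` has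
law `J`, as an extended nonnegative real. -/
noncomputable def infoRatio {N : ℕ} (J : Measure (Param N × (Action N × Obs))) : ℝ≥0∞ :=
  ENNReal.ofReal ((∫ z, (optReward z.1 - reward z.1 z.2.1 z.2.2) ∂J) ^ 2) / mutualInfo J

section Run

variable {N : ℕ} {Ω : Type*}

/-- The history process; `O t` denotes the observation `O_{t+1}` that follows the action `A_t`. -/
def hist (A : ℕ → Ω → Action N) (O : ℕ → Ω → Obs) (t : ℕ) (ω : Ω) : History N t :=
  fun s => (A s ω, O s ω)

variable [MeasurableSpace Ω]

/-- The conditional law of `((φ, θ), (A_t, O_{t+1}))` given `H_t = h`. -/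
noncomputable def condStepLaw (P : Measure Ω) (ψ : Ω → Param N) (A : ℕ → Ω → Action N)
    (O : ℕ → Ω → Obs) (t : ℕ) (h : History N t) : Measure (Param N × (Action N × Obs)) :=
  (P[|hist A O t ⁻¹' {h}]).map fun ω => (ψ ω, (A t ω, O t ω))

/-- The posterior: the conditional law of `(φ, θ)` given `H_t = h`. -/
noncomputable def posterior (P : Measure Ω) (ψ : Ω → Param N) (A : ℕ → Ω → Action N)
    (O : ℕ → Ω → Obs) (t : ℕ) (h : History N t) : Measure (Param N) :=
  (P[|hist A O t ⁻¹' {h}]).map ψ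

/-- On the probability space `(Ω, P)`, the agent `π` interacts with the beta-Bernoulli bandit
alignment problem: `ψ = (φ, θ)` has the prior law and, given `H_t = h`, the action `A_t` is drawn
from `π(· | h)` independently of `(φ, θ)`, and then `O_{t+1}` is drawn from `ρ_φ(· | A_t)` or
`ρ_θ(· | A_t)`. -/
structure IsInteraction (P : Measure Ω) (ψ : Ω → Param N) (A : ℕ → Ω → Action N)
    (O : ℕ → Ω → Obs) (π : Agent N) : Prop where
  measurable_param : Measurable ψ
  measurable_action : ∀ t, Measurable (A t)
  measurable_obs : ∀ t, Measurable (O t)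
  law_param : P.map ψ = prior N
  law_step : ∀ t h, P (hist A O t ⁻¹' {h}) ≠ 0 →
    condStepLaw P ψ A O t h = stepLaw (posterior P ψ A O t h) (π t h)

/-- The conditional information ratio
`Γ_t(π) = 𝔼_π[R* - R_{t+1} | H_t]² / 𝕀(φ, θ; A_t, O_{t+1} | H_t = H_t)`, a random variable. -/
noncomputable def condInfoRatio (P : Measure Ω) (ψ : Ω → Param N) (A : ℕ → Ω → Action N)
    (O : ℕ → Ω → Obs) (t : ℕ) (ω : Ω) : ℝ≥0∞ :=
  infoRatio (condStepLaw P ψ A O t (hist A O t ω))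

/-- `π` is an information-directed sampling agent: after every history `h` that occurs with
positive probability, `π(· | h)` minimizes, over all probability mass functions `ν` on the
actions, the conditional information ratio incurred when `A_t` is drawn from `ν`. -/
def IsIDS (P : Measure Ω) (ψ : Ω → Param N) (A : ℕ → Ω → Action N) (O : ℕ → Ω → Obs)
    (π : Agent N) : Prop :=
  ∀ t h, P (hist A O t ⁻¹' {h}) ≠ 0 → ∀ ν : PMF (Action N),
    infoRatio (stepLaw (posterior P ψ A O t h) (π t h)) ≤
      infoRatio (stepLaw (posterior P ψ A O t h) ν)

end Run

end BanditAlignment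

namespace BanditAlignment

/-! An IDS agent minimizes the information ratio, so each term is bounded by the ratio of any one
convenient policy. Conjugacy keeps the posterior a product of beta laws with all parameters at least
1, and each observation raises exactly one parameter by 1. With `K` actions, the parameters after
`t` steps therefore total `t + 2K` (`exists_posterior_eq`).

Let `x` be the least explored action, with parameter sum `n`, and let `g` be the action of largest
posterior mean reward. The comparison policy plays `x` with probability `ε` and `g` otherwise. All
posterior variances are of order `1/n`, so a union bound in second moment gives `g` an expected
regret of at most `D = √(K / (4(n+1)))` (`integral_optReward_betaProd_le`). A Bernoulli observation
of a beta variable carries information at least `1/(6(n-1))` (`le_betaMeasure_info`), so the policy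
gains at least `ε/(6(n-1))`.

Taking `ε = D/2` when this is at most 1 makes the regret at most `2D` and the ratio at most `48 D
(n-1)`. Since `K n` is at most the parameter total, this is at most `24 √(t + K)`: poor exploration
makes `D` large but information cheap, and the two effects offset each other. Summing over `t < T`
gives the `√(K T³)` rate. -/

/-! ### Beta laws: moments, and the information in one Bernoulli observation. -/

lemma taylor_le_klFun {y : ℝ} (hy : 0 ≤ y) :
    (y - 1) ^ 2 / 2 - (y - 1) ^ 3 / 6 ≤ InformationTheory.klFun y := by
  set h : ℝ → ℝ := fun y => InformationTheory.klFun y - ((y - 1) ^ 2 / 2 - (y - 1) ^ 3 / 6) with hh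
  have hd : ∀ y, 0 < y → HasDerivAt h (Real.log y - ((y - 1) - (y - 1) ^ 2 / 2)) y := by
    intro y hy
    refine (InformationTheory.hasDerivAt_klFun hy.ne').sub ?_
    have h1 : HasDerivAt (fun y : ℝ => y - 1) 1 y := (hasDerivAt_id y).sub_const 1
    convert! ((h1.pow 2).div_const 2).sub ((h1.pow 3).div_const 6) using 1
    simp; ring
  have hd2 : ∀ y, 0 < y →
      HasDerivAt (fun y : ℝ => Real.log y - ((y - 1) - (y - 1) ^ 2 / 2)) (y⁻¹ - (1 - (y - 1))) y := by
    intro y hy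
    refine (Real.hasDerivAt_log hy.ne').sub ?_
    have h1 : HasDerivAt (fun y : ℝ => y - 1) 1 y := (hasDerivAt_id y).sub_const 1
    convert! h1.sub ((h1.pow 2).div_const 2) using 1
    simp
  -- The Taylor remainder at 1 has second derivative `(1 - y)² / y ≥ 0`, and it vanishes at 1
  -- together with its derivative, so its minimum is 0.
  have hc : ConvexOn ℝ (Set.Ici 0) h := by
    refine convexOn_of_hasDerivWithinAt2_nonneg (f' := fun y => Real.log y - ((y - 1) - (y - 1) ^ 2 / 2))
      (f'' := fun y => y⁻¹ - (1 - (y - 1))) (convex_Ici 0) ?_ ?_ ?_ ?_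
    · have := InformationTheory.continuous_klFun
      exact Continuous.continuousOn (by fun_prop)
    · intro y hy; rw [interior_Ici] at hy ⊢; exact (hd y hy).hasDerivWithinAt
    · intro y hy; rw [interior_Ici] at hy ⊢; exact (hd2 y hy).hasDerivWithinAt
    · intro y hy
      rw [interior_Ici] at hy
      have hy : 0 < y := hy
      have : y⁻¹ - (1 - (y - 1)) = (1 - y) ^ 2 / y := by field_simp; ring
      rw [this]; positivity
  have hmin : IsMinOn h (Set.Ici 0) 1 := by
    refine hc.isMinOn_of_rightDeriv_eq_zero (by simp) ?_
    rw [(hd 1 one_pos).hasDerivWithinAt.derivWithin (uniqueDiffWithinAt_Ioi 1)]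
    simp
  have := hmin (Set.mem_Ici.2 hy)
  simp only [hh, Set.mem_ofPred_eq, InformationTheory.klFun_one] at this
  linarith

lemma ae_betaMeasure_mem_Ioo (α β : ℝ) : ∀ᵐ x ∂betaMeasure α β, x ∈ Set.Ioo (0 : ℝ) 1 := by
  rw [betaMeasure, ae_withDensity_iff (by unfold betaPDF; fun_prop)]
  refine ae_of_all _ fun x hx => ?_
  by_contra h
  refine hx ?_
  rw [betaPDF_eq, if_neg (by exact h), ENNReal.ofReal_zero]

lemma beta_succ_left {α β : ℝ} (hα : 0 < α) (hβ : 0 < β) :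
    beta (α + 1) β = α / (α + β) * beta α β := by
  have h : Real.Gamma (α + β) ≠ 0 := (Real.Gamma_pos_of_pos (by positivity)).ne'
  rw [beta, beta, Real.Gamma_add_one hα.ne', show α + 1 + β = (α + β) + 1 by ring,
    Real.Gamma_add_one (by positivity)]
  field_simp

lemma beta_comm (α β : ℝ) : beta α β = beta β α := by
  rw [beta, beta, mul_comm (Real.Gamma α), add_comm]

lemma betaMeasure_withDensity_id {α β : ℝ} (hα : 0 < α) (hβ : 0 < β) :
    (betaMeasure α β).withDensity (fun x => ENNReal.ofReal x)
      = ENNReal.ofReal (α / (α + β)) • betaMeasure (α + 1) β := by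
  have hm : ∀ a b, Measurable (betaPDF a b) := fun a b => by unfold betaPDF; fun_prop
  rw [betaMeasure, betaMeasure, ← withDensity_mul _ (hm _ _) (by fun_prop),
    ← withDensity_smul _ (hm _ _)]
  congr 1
  ext x
  simp only [Pi.mul_apply, Pi.smul_apply, smul_eq_mul, betaPDF_eq]
  split_ifs with hx
  · have hb := beta_pos hα hβ
    rw [← ENNReal.ofReal_mul' hx.1.le, ← ENNReal.ofReal_mul (by positivity), beta_succ_left hα hβ,
      show α + 1 - 1 = (α - 1) + 1 by ring, Real.rpow_add_one hx.1.ne']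
    congr 1
    field_simp
  · simp

lemma betaMeasure_withDensity_one_sub {α β : ℝ} (hα : 0 < α) (hβ : 0 < β) :
    (betaMeasure α β).withDensity (fun x => ENNReal.ofReal (1 - x))
      = ENNReal.ofReal (β / (α + β)) • betaMeasure α (β + 1) := by
  have hm : ∀ a b, Measurable (betaPDF a b) := fun a b => by unfold betaPDF; fun_prop
  rw [betaMeasure, betaMeasure, ← withDensity_mul _ (hm _ _) (by fun_prop),
    ← withDensity_smul _ (hm _ _)]
  congr 1
  ext x
  simp only [Pi.mul_apply, Pi.smul_apply, smul_eq_mul, betaPDF_eq]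
  split_ifs with hx
  · have hb := beta_pos hα hβ
    have hx' : 0 < 1 - x := by linarith [hx.2]
    rw [← ENNReal.ofReal_mul' hx'.le, ← ENNReal.ofReal_mul (by positivity), beta_comm α (β + 1),
      beta_succ_left hβ hα, beta_comm β α, add_comm β α,
      show β + 1 - 1 = (β - 1) + 1 by ring, Real.rpow_add_one hx'.ne']
    congr 1
    field_simp
  · simp

lemma integral_mul_betaMeasure {α β : ℝ} (hα : 0 < α) (hβ : 0 < β) (f : ℝ → ℝ) :
    ∫ x, x * f x ∂betaMeasure α β = α / (α + β) * ∫ x, f x ∂betaMeasure (α + 1) β := by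
  have h := congrArg (fun μ : Measure ℝ => ∫ x, f x ∂μ) (betaMeasure_withDensity_id hα hβ)
  simp only [integral_smul_measure] at h
  rw [integral_withDensity_eq_integral_toReal_smul (by fun_prop) (by simp),
    ENNReal.toReal_ofReal (by positivity), smul_eq_mul] at h
  rw [← h]
  refine integral_congr_ae ?_
  filter_upwards [ae_betaMeasure_mem_Ioo α β] with x hx
  rw [ENNReal.toReal_ofReal hx.1.le, smul_eq_mul]

lemma integral_id_betaMeasure {α β : ℝ} (hα : 0 < α) (hβ : 0 < β) :
    ∫ x, x ∂betaMeasure α β = α / (α + β) := by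
  have := isProbabilityMeasureBeta (show 0 < α + 1 by positivity) hβ
  simpa using integral_mul_betaMeasure hα hβ (fun _ => 1)

lemma integral_sq_betaMeasure {α β : ℝ} (hα : 0 < α) (hβ : 0 < β) :
    ∫ x, x ^ 2 ∂betaMeasure α β = α / (α + β) * ((α + 1) / (α + β + 1)) := by
  simp_rw [sq]
  rw [integral_mul_betaMeasure hα hβ (fun x => x), integral_id_betaMeasure (by positivity) hβ,
    add_right_comm α 1 β]

lemma integral_cube_betaMeasure {α β : ℝ} (hα : 0 < α) (hβ : 0 < β) :
    ∫ x, x ^ 3 ∂betaMeasure α β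
      = α / (α + β) * ((α + 1) / (α + β + 1) * ((α + 2) / (α + β + 2))) := by
  simp_rw [pow_succ' _ 2]
  rw [integral_mul_betaMeasure hα hβ (fun x => x ^ 2), integral_sq_betaMeasure (by positivity) hβ,
    add_right_comm α 1 β, add_assoc α 1 1, add_assoc (α + β) 1 1]
  norm_num

lemma integrable_betaMeasure {α β : ℝ} (hα : 0 < α) (hβ : 0 < β) {f : ℝ → ℝ} (hf : Continuous f) :
    Integrable f (betaMeasure α β) := by
  have := isProbabilityMeasureBeta hα hβ
  obtain ⟨C, hC⟩ := isCompact_Icc.exists_bound_of_continuousOn (s := Set.Icc (0 : ℝ) 1)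
    hf.continuousOn
  refine Integrable.of_bound hf.measurable.aestronglyMeasurable C ?_
  filter_upwards [ae_betaMeasure_mem_Ioo α β] with x hx using hC x ⟨hx.1.le, hx.2.le⟩

/-- The variance of a beta variable, expanded, is at most `1 / (4 (α + β + 1))`. -/
lemma betaMeasure_variance_le {α β : ℝ} (hα : 0 < α) (hβ : 0 < β) :
    ∫ x, x ^ 2 ∂betaMeasure α β - (∫ x, x ∂betaMeasure α β) ^ 2 ≤ 1 / (4 * (α + β + 1)) := by
  rw [integral_sq_betaMeasure hα hβ, integral_id_betaMeasure hα hβ]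
  have : 1 / (4 * (α + β + 1)) - (α / (α + β) * ((α + 1) / (α + β + 1)) - (α / (α + β)) ^ 2)
      = (α - β) ^ 2 / (4 * (α + β + 1) * (α + β) ^ 2) := by
    field_simp; ring
  have h2 : 0 ≤ (α - β) ^ 2 / (4 * (α + β + 1) * (α + β) ^ 2) := by positivity
  linarith

/-- The mutual information between a beta variable and a Bernoulli observation of it is at least
`1 / (6 (α + β - 1))`. -/
lemma le_betaMeasure_info {α β : ℝ} (hα : 1 ≤ α) (hβ : 1 ≤ β) :
    ENNReal.ofReal (1 / (6 * (α + β - 1))) ≤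
      ENNReal.ofReal (α / (α + β)) *
          ∫⁻ x, ENNReal.ofReal (InformationTheory.klFun (x / (α / (α + β)))) ∂betaMeasure α β +
        ENNReal.ofReal (β / (α + β)) *
          ∫⁻ x, ENNReal.ofReal (InformationTheory.klFun ((1 - x) / (β / (α + β))))
            ∂betaMeasure α β := by
  have hα0 : 0 < α := by linarith
  have hβ0 : 0 < β := by linarith
  set n := α + β with hn
  have hn0 : 0 < n := by positivity
  set p := α / n with hp
  set q := β / n with hq
  have hp0 : 0 < p := by positivity
  have hq0 : 0 < q := by positivity
  have hk := InformationTheory.continuous_klFun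
  have := isProbabilityMeasureBeta hα0 hβ0
  rw [← lintegral_const_mul _ (by fun_prop), ← lintegral_const_mul _ (by fun_prop),
    ← lintegral_add_left (by fun_prop)]
  set F : ℝ → ℝ := fun x => p * InformationTheory.klFun (x / p)
    + q * InformationTheory.klFun ((1 - x) / q) with hF
  have h1 : ∫⁻ x, ENNReal.ofReal (F x) ∂betaMeasure α β
      = ∫⁻ x, (ENNReal.ofReal p * ENNReal.ofReal (InformationTheory.klFun (x / p)) +
        ENNReal.ofReal q * ENNReal.ofReal (InformationTheory.klFun ((1 - x) / q)))
        ∂betaMeasure α β := by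
    refine lintegral_congr_ae ?_
    filter_upwards [ae_betaMeasure_mem_Ioo α β] with x hx
    have a1 := InformationTheory.klFun_nonneg (div_nonneg hx.1.le hp0.le)
    have a2 := InformationTheory.klFun_nonneg (div_nonneg (sub_nonneg.2 hx.2.le) hq0.le)
    rw [hF, ENNReal.ofReal_add (by positivity) (by positivity), ENNReal.ofReal_mul hp0.le,
      ENNReal.ofReal_mul hq0.le]
  have hF0 : 0 ≤ᵐ[betaMeasure α β] F := by
    filter_upwards [ae_betaMeasure_mem_Ioo α β] with x hx
    have a1 := InformationTheory.klFun_nonneg (div_nonneg hx.1.le hp0.le)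
    have a2 := InformationTheory.klFun_nonneg (div_nonneg (sub_nonneg.2 hx.2.le) hq0.le)
    simp only [hF, Pi.zero_apply]
    positivity
  rw [← h1, ← ofReal_integral_eq_lintegral_ofReal
    (integrable_betaMeasure hα0 hβ0 (by fun_prop)) hF0]
  refine ENNReal.ofReal_le_ofReal ?_
  -- Coefficients of the cubic Taylor bound for `F` at the mean `p`. Since `c2 = 1/(2pq)`, the
  -- quadratic term integrates to `1/(2(n+1))` with no loss for skewed laws, which Pinsker's
  -- inequality would incur. The cubic term costs only a third moment.
  set c2 : ℝ := (1 / p + 1 / q) / 2 with hc2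
  set c3 : ℝ := (1 / p ^ 2 - 1 / q ^ 2) / 6 with hc3
  have hpq : q = 1 - p := by rw [hp, hq, hn]; field_simp; ring
  have h2 : ∫ x, (c2 * (x - p) ^ 2 - c3 * (x - p) ^ 3) ∂betaMeasure α β
      ≤ ∫ x, F x ∂betaMeasure α β := by
    refine integral_mono_ae (integrable_betaMeasure hα0 hβ0 (by fun_prop))
      (integrable_betaMeasure hα0 hβ0 (by fun_prop)) ?_
    filter_upwards [ae_betaMeasure_mem_Ioo α β] with x hx
    have a1 := mul_le_mul_of_nonneg_left (taylor_le_klFun (div_nonneg hx.1.le hp0.le)) hp0.le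
    have a2 := mul_le_mul_of_nonneg_left
      (taylor_le_klFun (div_nonneg (sub_nonneg.2 hx.2.le) hq0.le)) hq0.le
    refine le_trans (le_of_eq ?_) (add_le_add a1 a2)
    have e1 : x / p - 1 = (x - p) / p := by field_simp
    have e2 : (1 - x) / q - 1 = -(x - p) / q := by field_simp; rw [hpq]; ring
    rw [e1, e2, hc2, hc3]
    field_simp
    ring
  refine le_trans ?_ h2
  have h3 : ∫ x, (c2 * (x - p) ^ 2 - c3 * (x - p) ^ 3) ∂betaMeasure α β
      = (-c3) * ∫ x, x ^ 3 ∂betaMeasure α β + (c2 + 3 * c3 * p) * ∫ x, x ^ 2 ∂betaMeasure α β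
        + ((-2 * c2 * p - 3 * c3 * p ^ 2) * ∫ x, x ∂betaMeasure α β
          + (c2 * p ^ 2 + c3 * p ^ 3)) := by
    have i3 := integrable_betaMeasure hα0 hβ0 (f := fun x => (-c3) * x ^ 3) (by fun_prop)
    have i2 := integrable_betaMeasure hα0 hβ0 (f := fun x => (c2 + 3 * c3 * p) * x ^ 2)
      (by fun_prop)
    have i1 := integrable_betaMeasure hα0 hβ0
      (f := fun x => (-2 * c2 * p - 3 * c3 * p ^ 2) * x) (by fun_prop)
    rw [← integral_const_mul, ← integral_const_mul, ← integral_const_mul, ← integral_add i3 i2]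
    have : c2 * p ^ 2 + c3 * p ^ 3 = ∫ x, (c2 * p ^ 2 + c3 * p ^ 3) ∂betaMeasure α β := by simp
    rw [this, ← integral_add i1 (integrable_const _)]
    refine Eq.trans ?_ (integral_add (i3.add i2) (i1.add (integrable_const _)))
    refine integral_congr_ae (ae_of_all _ fun x => ?_)
    ring
  rw [h3, integral_id_betaMeasure hα0 hβ0, integral_sq_betaMeasure hα0 hβ0,
    integral_cube_betaMeasure hα0 hβ0]
  have h4 : (-c3) * (α / (α + β) * ((α + 1) / (α + β + 1) * ((α + 2) / (α + β + 2))))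
      + (c2 + 3 * c3 * p) * (α / (α + β) * ((α + 1) / (α + β + 1)))
        + ((-2 * c2 * p - 3 * c3 * p ^ 2) * (α / (α + β)) + (c2 * p ^ 2 + c3 * p ^ 3))
      = 1 / (2 * (n + 1)) - (β - α) ^ 2 / (3 * (α * β) * (n + 1) * (n + 2)) := by
    rw [hc2, hc3, hp, hq, hn]
    field_simp
    ring
  rw [h4]
  -- This is `(α - 1)(β - 1) ≥ 0`. The skewness correction is thus worst when one parameter equals
  -- 1, and there the bound still leaves `1/(6(n-1))`.
  have h5 : n - 1 ≤ α * β := by nlinarith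
  have hn1 : 0 < n - 1 := by linarith
  have h6 : (β - α) ^ 2 = n ^ 2 - 4 * (α * β) := by rw [hn]; ring
  have h7 : (β - α) ^ 2 / (3 * (α * β) * (n + 1) * (n + 2))
      ≤ (n - 2) ^ 2 / (3 * (n - 1) * (n + 1) * (n + 2)) := by
    rw [h6, div_le_div_iff₀ (by positivity) (by positivity)]
    have : 0 ≤ (3 * (n + 1) * (n + 2) * n ^ 2) * (α * β - (n - 1)) := by
      have := sub_nonneg.2 h5
      positivity
    nlinarith
  have h8 : 1 / (2 * (n + 1)) - (n - 2) ^ 2 / (3 * (n - 1) * (n + 1) * (n + 2)) - 1 / (6 * (n - 1))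
      = 8 * (n - 2) / (6 * (n - 1) * (n + 1) * (n + 2)) := by
    field_simp
    ring
  have h9 : 0 ≤ 8 * (n - 2) / (6 * (n - 1) * (n + 1) * (n + 2)) :=
    div_nonneg (by linarith) (by positivity)
  linarith

/-! ### Product beta laws and their conjugate updates. -/

/-- A density in one coordinate changes only that factor of a box measure. As `c` is invertible, it
can be moved to the other side, where uniqueness of the product measure on boxes applies. -/
lemma pi_withDensity_comp_eval {ι : Type*} [Fintype ι] [DecidableEq ι] {X : ι → Type*}
    [∀ i, MeasurableSpace (X i)] {μ μ' : ∀ i, Measure (X i)} [∀ i, SigmaFinite (μ i)]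
    [∀ i, SigmaFinite (μ' i)] {i : ι} {f : X i → ℝ≥0∞} (hf : Measurable f) {c : ℝ≥0∞}
    (hc : c ≠ 0) (hc' : c ≠ ∞) (hi : (μ i).withDensity f = c • μ' i)
    (hne : ∀ j, j ≠ i → μ' j = μ j) :
    (Measure.pi μ).withDensity (fun y => f (y i)) = c • Measure.pi μ' := by
  have h : Measure.pi μ' = c⁻¹ • (Measure.pi μ).withDensity (fun y => f (y i)) := by
    refine Measure.pi_eq fun s hs => ?_
    rw [Measure.smul_apply, withDensity_apply _ (MeasurableSet.univ_pi hs),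
      Measure.restrict_pi_pi, ← lintegral_map (f := f) (g := Function.eval i) hf (measurable_pi_apply i),
      Measure.pi_map_eval,
      lintegral_smul_measure, ← withDensity_apply _ (hs i), hi]
    rw [← Finset.mul_prod_erase Finset.univ _ (Finset.mem_univ i), Measure.smul_apply]
    simp only [smul_eq_mul, Measure.restrict_apply_univ]
    rw [Finset.prod_congr rfl fun j hj => by rw [← hne j (Finset.ne_of_mem_erase hj)]]
    rw [mul_left_comm (∏ j ∈ _, _), ← mul_assoc, ENNReal.inv_mul_cancel hc hc', one_mul, mul_comm]
  rw [h, smul_smul, ENNReal.mul_inv_cancel hc hc', one_smul]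

/-- Independent beta laws of all the parameters. -/
noncomputable def betaProd {N : ℕ} (α β : Action N → ℝ) : Measure (Param N) :=
  (Measure.pi fun x => betaMeasure (α x) (β x)).map (MeasurableEquiv.sumPiEquivProdPi fun _ => ℝ)

variable {N : ℕ}

instance : MeasurableSingletonClass (Action N) :=
  ⟨fun _ => measurableSet_sum_iff.2 ⟨.of_discrete, .of_discrete⟩⟩

@[fun_prop]
lemma measurable_successProb (x : Action N) : Measurable fun p : Param N => successProb p x := by
  cases x <;> simp only [successProb] <;> fun_prop

@[fun_prop]
lemma measurable_obsProb (x : Action N) (o : Obs) : Measurable fun p : Param N => obsProb p x o := by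
  cases o <;> simp only [obsProb] <;> simp <;> fun_prop

@[fun_prop]
lemma measurable_reward (x : Action N) (o : Obs) : Measurable fun p : Param N => reward p x o := by
  cases x <;> cases o <;> simp only [reward] <;> simp <;> fun_prop

@[fun_prop]
lemma measurable_meanReward (x : Action N) : Measurable fun p : Param N => meanReward p x := by
  unfold meanReward; fun_prop

@[fun_prop]
lemma measurable_optReward : Measurable fun p : Param N => optReward p :=
  Measurable.iSup fun x => measurable_meanReward x

lemma successProb_sumPiEquivProdPi (y : Action N → ℝ) (x : Action N) :
    successProb (MeasurableEquiv.sumPiEquivProdPi (fun _ => ℝ) y) x = y x := by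
  cases x <;> rfl

lemma prior_eq_betaProd (N : ℕ) : prior N = betaProd (fun _ => 1) (fun _ => 1) := by
  have := isProbabilityMeasureBeta (α := 1) (β := 1) one_pos one_pos
  exact (measurePreserving_sumPiEquivProdPi
    (fun _ : Action N => betaMeasure 1 1)).map_eq.symm

/-- Conjugacy: the likelihood of a success multiplies one beta density by `r`, that of a failure by
`1 - r`, which raises one exponent. The value of `c` is left unspecified because normalizing the
posterior removes it. -/
lemma betaProd_withDensity {α β : Action N → ℝ} (hα : ∀ x, 0 < α x) (hβ : ∀ x, 0 < β x)
    (x : Action N) (o : Obs) :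
    ∃ c : ℝ≥0∞, c ≠ 0 ∧ c ≠ ∞ ∧
      (betaProd α β).withDensity (fun p => ENNReal.ofReal (obsProb p x o)) =
      c • betaProd (if o then Function.update α x (α x + 1) else α)
        (if o then β else Function.update β x (β x + 1)) := by
  have hpos := fun x => add_pos (hα x) (hβ x)
  have := fun x => isProbabilityMeasureBeta (hα x) (hβ x)
  have key : ∀ (α' β' : Action N → ℝ) (c : ℝ≥0∞) (f : ℝ → ℝ≥0∞), Measurable f →
      (∀ x, 0 < α' x) → (∀ x, 0 < β' x) → c ≠ 0 → c ≠ ∞ →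
      (betaMeasure (α x) (β x)).withDensity f = c • betaMeasure (α' x) (β' x) →
      (∀ j, j ≠ x → α' j = α j ∧ β' j = β j) →
      (betaProd α β).withDensity (fun p => f (successProb p x)) = c • betaProd α' β' := by
    intro α' β' c f hf hα' hβ' hc hc' h hne
    have := fun x => isProbabilityMeasureBeta (hα' x) (hβ' x)
    have h1 := pi_withDensity_comp_eval (μ := fun x => betaMeasure (α x) (β x))
      (μ' := fun x => betaMeasure (α' x) (β' x)) hf hc hc' h
      (fun j hj => by rw [(hne j hj).1, (hne j hj).2])
    rw [betaProd, betaProd, ← Measure.map_smul, ← h1]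
    ext s hs
    rw [withDensity_apply _ hs, MeasurableEquiv.map_apply,
      withDensity_apply _ ((MeasurableEquiv.measurable _) hs),
      setLIntegral_map hs (by fun_prop) (MeasurableEquiv.measurable _)]
    simp only [successProb_sumPiEquivProdPi]
  cases o
  · refine ⟨ENNReal.ofReal (β x / (α x + β x)), ?_, ENNReal.ofReal_ne_top, ?_⟩
    · simpa using div_pos (hβ x) (hpos x)
    · simp only [obsProb, Bool.false_eq_true, if_false]
      refine key _ _ _ (fun r => ENNReal.ofReal (1 - r)) (by fun_prop) hα ?_ ?_
        ENNReal.ofReal_ne_top ?_ ?_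
      · intro y
        rcases eq_or_ne y x with rfl | h
        · simpa using add_pos (hβ y) one_pos
        · simpa [h] using hβ y
      · simpa using div_pos (hβ x) (hpos x)
      · simpa using betaMeasure_withDensity_one_sub (hα x) (hβ x)
      · intro j hj
        simp [hj]
  · refine ⟨ENNReal.ofReal (α x / (α x + β x)), ?_, ENNReal.ofReal_ne_top, ?_⟩
    · simpa using div_pos (hα x) (hpos x)
    · simp only [obsProb, if_true]
      refine key _ _ _ (fun r => ENNReal.ofReal r) (by fun_prop) ?_ hβ ?_
        ENNReal.ofReal_ne_top ?_ ?_
      · intro y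
        rcases eq_or_ne y x with rfl | h
        · simpa using add_pos (hα y) one_pos
        · simpa [h] using hα y
      · simpa using div_pos (hα x) (hpos x)
      · simpa using betaMeasure_withDensity_id (hα x) (hβ x)
      · intro j hj
        simp [hj]

section betaProd

variable {α β : Action N → ℝ} (hα : ∀ x, 0 < α x) (hβ : ∀ x, 0 < β x)
include hα hβ

lemma isProbabilityMeasure_betaProd : IsProbabilityMeasure (betaProd α β) := by
  have := fun x => isProbabilityMeasureBeta (hα x) (hβ x)
  exact Measure.isProbabilityMeasure_map (MeasurableEquiv.measurable _).aemeasurable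

lemma betaProd_map_successProb (x : Action N) :
    (betaProd α β).map (fun p => successProb p x) = betaMeasure (α x) (β x) := by
  have := fun x => isProbabilityMeasureBeta (hα x) (hβ x)
  rw [betaProd, Measure.map_map (by fun_prop) (MeasurableEquiv.measurable _)]
  simp only [Function.comp_def, successProb_sumPiEquivProdPi]
  exact (measurePreserving_eval (fun x => betaMeasure (α x) (β x)) x).map_eq

lemma ae_betaProd_mem_Ioo :
    ∀ᵐ p ∂betaProd α β, ∀ x : Action N, successProb p x ∈ Set.Ioo (0 : ℝ) 1 := by
  rw [ae_all_iff]
  intro x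
  have h := ae_betaMeasure_mem_Ioo (α x) (β x)
  rw [← betaProd_map_successProb hα hβ x] at h
  exact ae_of_ae_map (measurable_successProb x).aemeasurable h

lemma integral_betaProd_comp {f : ℝ → ℝ} (hf : Continuous f) (x : Action N) :
    ∫ p, f (successProb p x) ∂betaProd α β = ∫ r, f r ∂betaMeasure (α x) (β x) := by
  rw [← betaProd_map_successProb hα hβ x, integral_map (by fun_prop)
    hf.aestronglyMeasurable]

lemma integral_betaProd_mul {f g : ℝ → ℝ} (hf : Continuous f) (hg : Continuous g)
    {x y : Action N} (hxy : x ≠ y) :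
    ∫ p, f (successProb p x) * g (successProb p y) ∂betaProd α β =
      (∫ r, f r ∂betaMeasure (α x) (β x)) * ∫ r, g r ∂betaMeasure (α y) (β y) := by
  have := fun x => isProbabilityMeasureBeta (hα x) (hβ x)
  rw [betaProd, integral_map_equiv]
  simp only [successProb_sumPiEquivProdPi]
  have hI := (iIndepFun_pi (μ := fun x => betaMeasure (α x) (β x)) (X := fun _ => id)
    (fun _ => aemeasurable_id)).indepFun hxy
  have := (hI.comp hf.measurable hg.measurable).integral_fun_mul_eq_mul_integral
    (by simp only [Function.comp_def, id]; exact (hf.measurable.comp (measurable_pi_apply _)).aestronglyMeasurable)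
    (by simp only [Function.comp_def, id]; exact (hg.measurable.comp (measurable_pi_apply _)).aestronglyMeasurable)
  simp only [Function.comp_def, id] at this
  rw [this, integral_comp_eval (i := x) (μ := fun x => betaMeasure (α x) (β x))
    hf.aestronglyMeasurable, integral_comp_eval (i := y) (μ := fun x => betaMeasure (α x) (β x))
    hg.aestronglyMeasurable]

end betaProd

lemma stepLaw_prod_singleton (μ : Measure (Param N)) (ν : PMF (Action N)) (x : Action N × Obs)
    {B : Set (Param N)} (hB : MeasurableSet B) :
    stepLaw μ ν (B ×ˢ {x})
      = ν x.1 * μ.withDensity (fun p => ENNReal.ofReal (obsProb p x.1 x.2)) B := by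
  have hm : ∀ y : Action N × Obs, Measurable fun p : Param N => (p, y) := fun y => by fun_prop
  rw [stepLaw, Measure.finsetSum_apply, Finset.sum_eq_single x]
  · rw [Measure.map_apply (hm x) (hB.prod (measurableSet_singleton x)),
      show (fun p => (p, x)) ⁻¹' B ×ˢ {x} = B by ext; simp,
      withDensity_apply _ hB, withDensity_apply _ hB, lintegral_const_mul _ (by fun_prop)]
  · intro y _ hy
    rw [Measure.map_apply (hm y) (hB.prod (measurableSet_singleton x)),
      show (fun p => (p, y)) ⁻¹' B ×ˢ {x} = ∅ by ext; simp [hy], measure_empty]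
  · simp

/-! ### The posterior along an interaction. -/

section Interaction

variable {Ω : Type*} [MeasurableSpace Ω] {P : Measure Ω} {ψ : Ω → Param N} {A : ℕ → Ω → Action N} {O : ℕ → Ω → Obs} {π : Agent N}

lemma IsInteraction.measurable_hist (hrun : IsInteraction P ψ A O π) (t : ℕ) :
    Measurable (hist A O t) :=
  measurable_pi_lambda _ fun s => (hrun.measurable_action s).prodMk (hrun.measurable_obs s)

/-- Induction on `t` by Bayes' rule. Each prior factor contributes `1 + 1` to the parameter total
and each observation adds 1, whichever action was taken; only this total enters the final bound. -/
lemma IsInteraction.exists_posterior_eq [IsProbabilityMeasure P] (hrun : IsInteraction P ψ A O π) (t : ℕ)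
    (h : History N t) (hh : P (hist A O t ⁻¹' {h}) ≠ 0) :
    ∃ a b : Action N → ℝ, (∀ x, 1 ≤ a x) ∧ (∀ x, 1 ≤ b x) ∧
      ∑ x, (a x + b x) = t + 2 * Fintype.card (Action N) ∧ posterior P ψ A O t h = betaProd a b := by
  induction t with
  | zero =>
    refine ⟨fun _ => 1, fun _ => 1, fun _ => le_rfl, fun _ => le_rfl, ?_, ?_⟩
    · simp; ring
    · have : hist A O 0 ⁻¹' {h} = Set.univ := by
        ext ω; simp [Subsingleton.elim (hist A O 0 ω) h]
      rw [posterior, this, cond_univ, hrun.law_param, prior_eq_betaProd]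
  | succ t ih =>
    set h0 : History N t := fun s => h s.castSucc with hh0
    set x := h (Fin.last t) with hx
    have hset : hist A O (t + 1) ⁻¹' {h}
        = hist A O t ⁻¹' {h0} ∩ (fun ω => (A t ω, O t ω)) ⁻¹' {x} := by
      ext ω
      simp only [Set.mem_preimage, Set.mem_singleton_iff, Set.mem_inter_iff]
      constructor
      · rintro rfl
        exact ⟨rfl, rfl⟩
      · rintro ⟨h1, h2⟩
        funext s
        refine Fin.lastCases h2 (fun s => ?_) s
        exact congrFun h1 s
    have hP0 : P (hist A O t ⁻¹' {h0}) ≠ 0 := fun h0 =>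
      hh (measure_mono_null (hset ▸ Set.inter_subset_left) h0)
    obtain ⟨a, b, ha, hb, hab, hpost⟩ := ih h0 hP0
    have ha0 := fun x => one_pos.trans_le (ha x)
    have hb0 := fun x => one_pos.trans_le (hb x)
    obtain ⟨c, hc0, hc1, hc⟩ := betaProd_withDensity ha0 hb0 x.1 x.2
    set a' := if x.2 then Function.update a x.1 (a x.1 + 1) else a with ha'
    set b' := if x.2 then b else Function.update b x.1 (b x.1 + 1) with hb'
    have hup : ∀ (d : Action N → ℝ) (y : Action N), (∀ x, 1 ≤ d x) →
        ∀ x, 1 ≤ Function.update d y (d y + 1) x := by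
      intro d y hd x
      rcases eq_or_ne x y with rfl | hne
      · simp only [Function.update_self]; linarith [hd x]
      · simpa [hne] using hd x
    have ha1 : ∀ x, 1 ≤ a' x := by
      intro y; rw [ha']; split_ifs
      exacts [hup a x.1 ha y, ha y]
    have hb1 : ∀ x, 1 ≤ b' x := by
      intro y; rw [hb']; split_ifs
      exacts [hb y, hup b x.1 hb y]
    refine ⟨a', b', ha1, hb1, ?_, ?_⟩
    · have hs : ∀ d : Action N → ℝ, ∑ y, Function.update d x.1 (d x.1 + 1) y = ∑ y, d y + 1 := by
        intro d
        rw [Finset.sum_update_of_mem (Finset.mem_univ _),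
          ← Finset.add_sum_erase _ d (Finset.mem_univ x.1), Finset.sdiff_singleton_eq_erase]
        ring
      rw [Finset.sum_add_distrib] at hab ⊢
      rw [ha', hb']
      split_ifs <;> rw [hs] <;> push_cast <;> linarith
    · have hm0 : MeasurableSet (hist A O t ⁻¹' {h0}) :=
        hrun.measurable_hist t (measurableSet_singleton _)
      have hm1 : MeasurableSet (hist A O (t + 1) ⁻¹' {h}) :=
        hrun.measurable_hist (t + 1) (measurableSet_singleton _)
      have hmz : Measurable fun ω => (ψ ω, (A t ω, O t ω)) :=
        hrun.measurable_param.prodMk ((hrun.measurable_action t).prodMk (hrun.measurable_obs t))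
      have := isProbabilityMeasure_betaProd (fun x => one_pos.trans_le (ha1 x))
        (fun x => one_pos.trans_le (hb1 x))
      -- The policy weight `π t h0 x.1` does not depend on the parameters, so it joins `c` in a
      -- factor independent of `B`; the case `B = univ` identifies that factor and conditioning
      -- cancels it.
      have key : ∀ B, MeasurableSet B → P (hist A O (t + 1) ⁻¹' {h} ∩ ψ ⁻¹' B)
          = P (hist A O t ⁻¹' {h0}) * (π t h0 x.1 * c) * betaProd a' b' B := by
        intro B hB
        have e := congrArg (fun J => J (B ×ˢ {x})) (hrun.law_step t h0 hP0)
        simp only [condStepLaw] at e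
        rw [Measure.map_apply hmz (hB.prod (measurableSet_singleton x)), cond_apply hm0,
          stepLaw_prod_singleton _ _ _ hB, hpost, hc, Measure.smul_apply, smul_eq_mul] at e
        have e2 : hist A O (t + 1) ⁻¹' {h} ∩ ψ ⁻¹' B = hist A O t ⁻¹' {h0} ∩
            (fun ω => (ψ ω, (A t ω, O t ω))) ⁻¹' B ×ˢ {x} := by
          rw [hset]; ext ω; simp; tauto
        rw [e2, mul_assoc, mul_assoc, ← e, ← mul_assoc,
          ENNReal.mul_inv_cancel hP0 (measure_ne_top _ _), one_mul]
      have hk := key Set.univ MeasurableSet.univ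
      rw [Set.preimage_univ, Set.inter_univ, measure_univ, mul_one] at hk
      ext B hB
      rw [posterior, Measure.map_apply hrun.measurable_param hB, cond_apply hm1, key B hB, ← hk,
        ← mul_assoc, ENNReal.inv_mul_cancel hh (measure_ne_top _ _), one_mul]

end Interaction

/-! ### The law of one step: marginals, density and mutual information. -/

lemma lintegral_stepLaw (μ : Measure (Param N)) (ν : PMF (Action N))
    {f : Param N × (Action N × Obs) → ℝ≥0∞} (hf : Measurable f) :
    ∫⁻ z, f z ∂stepLaw μ ν
      = ∑ x : Action N × Obs,
        ν x.1 * ∫⁻ p, ENNReal.ofReal (obsProb p x.1 x.2) * f (p, x) ∂μ := by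
  rw [stepLaw, lintegral_finsetSum_measure]
  refine Finset.sum_congr rfl fun x _ => ?_
  rw [lintegral_map hf (by fun_prop), lintegral_withDensity_eq_lintegral_mul _ (by fun_prop)
    (by fun_prop), ← lintegral_const_mul _ (by fun_prop)]
  simp only [Pi.mul_apply, mul_assoc]

lemma obsProb_mem_Ioo {p : Param N} (hp : ∀ x, successProb p x ∈ Set.Ioo (0 : ℝ) 1)
    (x : Action N) (o : Obs) : obsProb p x o ∈ Set.Ioo (0 : ℝ) 1 := by
  have := hp x
  cases o
  · simpa [obsProb] using this.symm
  · simpa [obsProb] using this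

lemma sum_obsProb (p : Param N) (x : Action N) : ∑ o, obsProb p x o = 1 := by
  simp [obsProb]

section

variable {μ : Measure (Param N)}
  (hμ : ∀ᵐ p ∂μ, ∀ x, successProb p x ∈ Set.Ioo (0 : ℝ) 1) (ν : PMF (Action N))
include hμ

/-- The observation probabilities of each action sum to 1. The hypothesis `hμ` ensures that
`ENNReal.ofReal` does not truncate them. -/
lemma stepLaw_map_fst : (stepLaw μ ν).map Prod.fst = μ := by
  ext B hB
  rw [Measure.map_apply measurable_fst hB, ← lintegral_indicator_one (measurable_fst hB),
    lintegral_stepLaw _ _ (measurable_one.indicator (measurable_fst hB)),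
    Fintype.sum_prod_type]
  have h : ∀ a, ∑ o, ∫⁻ p, ENNReal.ofReal (obsProb p a o) *
      (Prod.fst ⁻¹' B).indicator 1 (p, (a, o)) ∂μ = μ B := by
    intro a
    rw [← lintegral_finsetSum _ fun o _ => by
      refine Measurable.mul (by fun_prop) ?_
      exact (measurable_one.indicator (measurable_fst hB)).comp
        (by fun_prop : Measurable fun p : Param N => (p, (a, o)))]
    rw [← lintegral_indicator_one hB]
    refine lintegral_congr_ae ?_
    filter_upwards [hμ] with p hp
    have e : ∀ o : Obs, (Prod.fst ⁻¹' B).indicator (1 : Param N × (Action N × Obs) → ℝ≥0∞)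
      (p, (a, o)) = B.indicator 1 p := fun o => rfl
    simp only [e]
    rw [← Finset.sum_mul, ← ENNReal.ofReal_sum_of_nonneg fun o _ => (obsProb_mem_Ioo hp a o).1.le,
      sum_obsProb, ENNReal.ofReal_one, one_mul]
  simp only [← Finset.mul_sum, h]
  rw [← Finset.sum_mul, ← tsum_fintype (L := .unconditional _), ν.tsum_coe, one_mul]

omit hμ in
lemma lintegral_stepLaw_map_snd {f : Action N × Obs → ℝ≥0∞} :
    ∫⁻ x, f x ∂(stepLaw μ ν).map Prod.snd
      = ∑ x : Action N × Obs, ν x.1 * (∫⁻ p, ENNReal.ofReal (obsProb p x.1 x.2) ∂μ) * f x := by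
  rw [lintegral_map (measurable_of_finite f) measurable_snd,
    lintegral_stepLaw (f := fun z => f z.2) _ _ ((measurable_of_finite f).comp measurable_snd)]
  refine Finset.sum_congr rfl fun x _ => ?_
  dsimp only
  rw [lintegral_mul_const _ (by fun_prop), mul_assoc]

variable [IsProbabilityMeasure μ]

lemma isProbabilityMeasure_stepLaw : IsProbabilityMeasure (stepLaw μ ν) := by
  refine ⟨?_⟩
  have := congrArg (fun m => m Set.univ) (stepLaw_map_fst hμ ν)
  simpa [Measure.map_apply measurable_fst] using this

lemma integral_obsProb_pos (a : Action N) (o : Obs) : 0 < ∫ p, obsProb p a o ∂μ := by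
  have hnn : 0 ≤ᵐ[μ] fun p => obsProb p a o := by
    filter_upwards [hμ] with p hp using (obsProb_mem_Ioo hp a o).1.le
  have hi : Integrable (fun p => obsProb p a o) μ := by
    refine Integrable.of_bound (by fun_prop) 1 ?_
    filter_upwards [hμ] with p hp
    rw [Real.norm_eq_abs, abs_of_pos (obsProb_mem_Ioo hp a o).1]
    exact (obsProb_mem_Ioo hp a o).2.le
  rw [integral_pos_iff_support_of_nonneg_ae hnn hi]
  have : Function.support (fun p => obsProb p a o) =ᵐ[μ] Set.univ := by
    rw [ae_eq_univ]
    change ∀ᵐ p ∂μ, p ∈ Function.support fun p => obsProb p a o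
    filter_upwards [hμ] with p hp using (obsProb_mem_Ioo hp a o).1.ne'
  rw [measure_congr this, measure_univ]
  exact one_pos

lemma lintegral_obsProb (a : Action N) (o : Obs) :
    ∫⁻ p, ENNReal.ofReal (obsProb p a o) ∂μ = ENNReal.ofReal (∫ p, obsProb p a o ∂μ) := by
  have hnn : 0 ≤ᵐ[μ] fun p => obsProb p a o := by
    filter_upwards [hμ] with p hp using (obsProb_mem_Ioo hp a o).1.le
  have hi : Integrable (fun p => obsProb p a o) μ :=
    Integrable.of_integral_ne_zero (integral_obsProb_pos hμ a o).ne'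
  rw [ofReal_integral_eq_lintegral_ofReal hi hnn]

/-- The step law has an explicit density with respect to the product of its marginals. -/
lemma stepLaw_eq_withDensity :
    stepLaw μ ν = (μ.prod ((stepLaw μ ν).map Prod.snd)).withDensity fun z =>
      ENNReal.ofReal (obsProb z.1 z.2.1 z.2.2 / ∫ p, obsProb p z.2.1 z.2.2 ∂μ) := by
  have := isProbabilityMeasure_stepLaw hμ ν
  have hd : Measurable fun z : Param N × (Action N × Obs) =>
      ENNReal.ofReal (obsProb z.1 z.2.1 z.2.2 / ∫ p, obsProb p z.2.1 z.2.2 ∂μ) :=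
    measurable_from_prod_countable_left fun x => by
      change Measurable fun p : Param N => _; dsimp only; fun_prop
  ext S hS
  have h1 : Measurable (S.indicator (1 : Param N × (Action N × Obs) → ℝ≥0∞)) :=
    measurable_one.indicator hS
  rw [withDensity_apply _ hS, ← lintegral_indicator_one hS, lintegral_stepLaw _ _ h1,
    ← lintegral_indicator hS, lintegral_prod_symm' _ (hd.indicator hS), lintegral_stepLaw_map_snd]
  refine Finset.sum_congr rfl fun x _ => ?_
  have hpos := integral_obsProb_pos hμ x.1 x.2
  rw [mul_assoc, lintegral_obsProb hμ]
  congr 1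
  rw [← lintegral_const_mul _
    (by exact (hd.indicator hS).comp (by fun_prop : Measurable fun p : Param N => (p, x)))]
  refine lintegral_congr fun p => ?_
  by_cases hp : (p, x) ∈ S
  · simp only [hp, Set.indicator_of_mem, Pi.one_apply, mul_one]
    rw [← ENNReal.ofReal_mul hpos.le]
    congr 1
    field_simp
  · simp [hp]

/-- The mutual information is at least the contribution of a single action. -/
lemma le_mutualInfo_stepLaw (a : Action N) :
    ν a * ∑ o, ENNReal.ofReal (∫ p, obsProb p a o ∂μ) *
        ∫⁻ p, ENNReal.ofReal (InformationTheory.klFun (obsProb p a o / ∫ p, obsProb p a o ∂μ)) ∂μ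
      ≤ mutualInfo (stepLaw μ ν) := by
  have := isProbabilityMeasure_stepLaw hμ ν
  have hJ := stepLaw_eq_withDensity hμ ν
  have hsnd : IsProbabilityMeasure ((stepLaw μ ν).map Prod.snd) :=
    Measure.isProbabilityMeasure_map (by fun_prop)
  have hd : Measurable fun z : Param N × (Action N × Obs) =>
      obsProb z.1 z.2.1 z.2.2 / ∫ p, obsProb p z.2.1 z.2.2 ∂μ :=
    measurable_from_prod_countable_left fun x => by
      change Measurable fun p : Param N => _; dsimp only; fun_prop
  have hk := InformationTheory.measurable_klFun
  have hrn : (stepLaw μ ν).rnDeriv (μ.prod ((stepLaw μ ν).map Prod.snd))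
      =ᵐ[μ.prod ((stepLaw μ ν).map Prod.snd)] fun z =>
      ENNReal.ofReal (obsProb z.1 z.2.1 z.2.2 / ∫ p, obsProb p z.2.1 z.2.2 ∂μ) := by
    have := Measure.rnDeriv_withDensity (μ.prod ((stepLaw μ ν).map Prod.snd)) hd.ennreal_ofReal
    rwa [← hJ] at this
  have hac : stepLaw μ ν ≪ μ.prod ((stepLaw μ ν).map Prod.snd) := by
    conv_lhs => rw [hJ]
    exact withDensity_absolutelyContinuous _ _
  rw [mutualInfo, stepLaw_map_fst hμ ν, InformationTheory.klDiv_eq_lintegral_klFun_of_ac hac,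
    lintegral_congr_ae (hrn.mono fun z hz => by rw [hz]),
    lintegral_prod_symm' _ (by exact (hk.comp hd.ennreal_ofReal.ennreal_toReal).ennreal_ofReal),
    lintegral_stepLaw_map_snd, Fintype.sum_prod_type]
  -- Writing the divergence through `klFun` makes every action's contribution nonnegative, so all
  -- but that of `a` may be dropped.
  refine le_trans (le_of_eq ?_) (Finset.single_le_sum (fun _ _ => zero_le) (Finset.mem_univ a))
  rw [Finset.mul_sum]
  refine Finset.sum_congr rfl fun o _ => ?_
  rw [lintegral_obsProb hμ, mul_assoc]
  congr 2
  refine lintegral_congr_ae ?_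
  filter_upwards [hμ] with p hp
  rw [ENNReal.toReal_ofReal]
  exact div_nonneg (obsProb_mem_Ioo hp a o).1.le (integral_obsProb_pos hμ a o).le

end

/-! ### Rewards and the expected regret of one step. -/

lemma integral_stepLaw {μ : Measure (Param N)} [IsProbabilityMeasure μ]
    (hμ : ∀ᵐ p ∂μ, ∀ x, successProb p x ∈ Set.Ioo (0 : ℝ) 1) (ν : PMF (Action N))
    {f : Param N × (Action N × Obs) → ℝ} (hf : Measurable f) {C : ℝ}
    (hC : ∀ᵐ p ∂μ, ∀ x, ‖f (p, x)‖ ≤ C) :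
    ∫ z, f z ∂stepLaw μ ν = ∑ x : Action N × Obs,
      (ν x.1).toReal * ∫ p, obsProb p x.1 x.2 * f (p, x) ∂μ := by
  have hm : ∀ x : Action N × Obs, Measurable fun p : Param N => (p, x) := fun x => by fun_prop
  have hle : ∀ x : Action N × Obs,
      ∀ᵐ p ∂μ, ν x.1 * ENNReal.ofReal (obsProb p x.1 x.2) ≤ 1 := by
    intro x
    filter_upwards [hμ] with p hp
    exact mul_le_one' (ν.coe_le_one _)
      (ENNReal.ofReal_le_one.2 (obsProb_mem_Ioo hp x.1 x.2).2.le)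
  rw [stepLaw, integral_finsetSum_measure]
  · refine Finset.sum_congr rfl fun x _ => ?_
    rw [integral_map (hm x).aemeasurable hf.aestronglyMeasurable,
      integral_withDensity_eq_integral_toReal_smul (by fun_prop)
        ((hle x).mono fun p hp => hp.trans_lt ENNReal.one_lt_top), ← integral_const_mul]
    refine integral_congr_ae ?_
    filter_upwards [hμ] with p hp
    rw [ENNReal.toReal_mul, ENNReal.toReal_ofReal (obsProb_mem_Ioo hp x.1 x.2).1.le, smul_eq_mul,
      mul_assoc]
  · intro x _
    rw [integrable_map_measure hf.aestronglyMeasurable (hm x).aemeasurable]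
    have : IsFiniteMeasure
        (μ.withDensity fun p => ν x.1 * ENNReal.ofReal (obsProb p x.1 x.2)) := by
      refine isFiniteMeasure_withDensity (ne_top_of_le_ne_top ENNReal.one_ne_top ?_)
      simpa using lintegral_mono_ae (hle x)
    refine Integrable.of_bound (hf.comp (hm x)).aestronglyMeasurable C ?_
    exact withDensity_absolutelyContinuous _ _ (hC.mono fun p hp => hp x)

lemma meanReward_inl (p : Param N) (i : Fin N) : meanReward p (Sum.inl i) =
    successProb p (.inl i) * successProb p (.inr i)
      + (1 - successProb p (.inl i)) * (1 - successProb p (.inr i)) := by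
  simp [meanReward, obsProb, reward, successProb]

lemma meanReward_inr (p : Param N) (i : Fin N) : meanReward p (Sum.inr i) = -1 := by
  simp [meanReward, obsProb, reward]

section Bounds

variable {p : Param N} (hp : ∀ x, successProb p x ∈ Set.Ioo (0 : ℝ) 1)
include hp

lemma abs_reward_le (x : Action N) (o : Obs) : |reward p x o| ≤ 1 := by
  cases x with
  | inl i =>
    have h : p.2 i ∈ Set.Ioo (0 : ℝ) 1 := hp (.inr i)
    rw [abs_le]
    cases o <;> simp [reward] <;> constructor <;> linarith [h.1, h.2]
  | inr i => simp [reward]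

lemma abs_meanReward_le (x : Action N) : |meanReward p x| ≤ 1 := by
  calc |meanReward p x| ≤ ∑ o, |obsProb p x o * reward p x o| := Finset.abs_sum_le_sum_abs _ _
    _ ≤ ∑ o, obsProb p x o := Finset.sum_le_sum fun o _ => by
      have h := obsProb_mem_Ioo hp x o
      rw [abs_mul, abs_of_pos h.1]
      exact mul_le_of_le_one_right h.1.le (abs_reward_le hp x o)
    _ = 1 := sum_obsProb p x

lemma abs_optReward_le [Nonempty (Action N)] : |optReward p| ≤ 1 := by
  obtain ⟨x⟩ := ‹Nonempty (Action N)›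
  have : Nonempty (Action N) := ⟨x⟩
  rw [abs_le]
  exact ⟨(abs_le.1 (abs_meanReward_le hp x)).1.trans (le_ciSup (Set.finite_range _).bddAbove x),
    ciSup_le fun y => (abs_le.1 (abs_meanReward_le hp y)).2⟩

end Bounds

section Regret

variable [Nonempty (Action N)] {μ : Measure (Param N)} [IsProbabilityMeasure μ]
  (hμ : ∀ᵐ p ∂μ, ∀ x, successProb p x ∈ Set.Ioo (0 : ℝ) 1)
include hμ

lemma integrable_optReward : Integrable (fun p => optReward p) μ :=
  Integrable.of_bound (by fun_prop) 1 (hμ.mono fun _ hp => abs_optReward_le hp)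

omit [Nonempty (Action N)] in
lemma integrable_meanReward (x : Action N) : Integrable (fun p => meanReward p x) μ :=
  Integrable.of_bound (by fun_prop) 1 (hμ.mono fun _ hp => abs_meanReward_le hp x)

omit [Nonempty (Action N)] in
lemma abs_integral_meanReward_le (x : Action N) : |∫ p, meanReward p x ∂μ| ≤ 1 := by
  simpa using norm_integral_le_of_norm_le_const (f := fun p => meanReward p x)
    (hμ.mono fun _ hp => abs_meanReward_le hp x)

lemma abs_integral_optReward_le : |∫ p, optReward p ∂μ| ≤ 1 := by
  simpa using norm_integral_le_of_norm_le_const (f := fun p => optReward p)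
    (hμ.mono fun _ hp => abs_optReward_le hp)

lemma integral_meanReward_le_integral_optReward (x : Action N) :
    ∫ p, meanReward p x ∂μ ≤ ∫ p, optReward p ∂μ :=
  integral_mono (integrable_meanReward hμ x) (integrable_optReward hμ) fun _ =>
    le_ciSup (Set.finite_range _).bddAbove x

/-- Averaging over the observation replaces the reward by `meanReward`, so the expected regret is
linear in the policy. -/
lemma integral_regret_stepLaw (ν : PMF (Action N)) :
    ∫ z, (optReward z.1 - reward z.1 z.2.1 z.2.2) ∂stepLaw μ ν
      = ∑ x, (ν x).toReal * (∫ p, optReward p ∂μ - ∫ p, meanReward p x ∂μ) := by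
  have hb : ∀ᵐ p ∂μ, ∀ x : Action N × Obs, ‖optReward p - reward p x.1 x.2‖ ≤ 2 := by
    filter_upwards [hμ] with p hp x
    have h1 := abs_sub (optReward p) (reward p x.1 x.2)
    have h2 := abs_optReward_le hp
    have h3 := abs_reward_le hp x.1 x.2
    rw [Real.norm_eq_abs]
    linarith
  have hm : Measurable fun z : Param N × (Action N × Obs) =>
      optReward z.1 - reward z.1 z.2.1 z.2.2 :=
    measurable_from_prod_countable_left fun x => by
      change Measurable fun p : Param N => _; dsimp only; fun_prop
  rw [integral_stepLaw hμ ν hm hb, Fintype.sum_prod_type]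
  refine Finset.sum_congr rfl fun a _ => ?_
  dsimp only
  rw [← Finset.mul_sum, ← integral_finsetSum]
  · rw [← integral_sub (integrable_optReward hμ) (integrable_meanReward hμ a)]
    congr 1
    refine integral_congr_ae (ae_of_all _ fun p => ?_)
    dsimp only
    rw [meanReward]
    simp only [mul_sub]
    rw [Finset.sum_sub_distrib, ← Finset.sum_mul, sum_obsProb, one_mul]
  · intro o _
    refine Integrable.of_bound (by fun_prop) 2 ?_
    filter_upwards [hμ, hb] with p hp hb
    have h := obsProb_mem_Ioo hp a o
    rw [norm_mul, Real.norm_eq_abs, abs_of_pos h.1]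
    exact (mul_le_of_le_one_left (norm_nonneg _) h.2.le).trans (hb (a, o))

end Regret

/-! ### Regret of the greedy action under product beta laws. -/

lemma integral_sub_mean_sq_betaMeasure_le {α β : ℝ} (hα : 0 < α) (hβ : 0 < β) :
    ∫ x, (x - ∫ x, x ∂betaMeasure α β) ^ 2 ∂betaMeasure α β ≤ 1 / (4 * (α + β + 1)) := by
  have := isProbabilityMeasureBeta hα hβ
  refine le_trans (le_of_eq ?_) (betaMeasure_variance_le hα hβ)
  set s := ∫ x, x ∂betaMeasure α β with hs
  have h2 := integrable_betaMeasure hα hβ (f := fun x => x ^ 2) (by fun_prop)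
  have h1 := integrable_betaMeasure hα hβ (f := fun x => 2 * s * x) (by fun_prop)
  have h : ∀ x : ℝ, (x - s) ^ 2 = x ^ 2 - 2 * s * x + s ^ 2 := fun x => by ring
  have h3 : Integrable (fun x => x ^ 2 - 2 * s * x) (betaMeasure α β) := h2.sub h1
  simp_rw [h]
  rw [integral_add h3 (integrable_const _), integral_sub h2 h1, integral_const_mul, ← hs]
  simp
  ring

section betaProd

variable {α β : Action N → ℝ} (hα : ∀ x, 0 < α x) (hβ : ∀ x, 0 < β x)
include hα hβ

lemma integral_sub_mean_betaProd_mul {g : ℝ → ℝ} (hg : Continuous g) {x y : Action N}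
    (hxy : x ≠ y) :
    ∫ p, (successProb p x - ∫ r, r ∂betaMeasure (α x) (β x)) * g (successProb p y) ∂betaProd α β
      = 0 := by
  have := isProbabilityMeasureBeta (hα x) (hβ x)
  rw [integral_betaProd_mul hα hβ (f := fun r => r - ∫ r, r ∂betaMeasure (α x) (β x))
    (by fun_prop) hg hxy, integral_sub (integrable_betaMeasure (hα x) (hβ x) (f := fun r => r) (by fun_prop))
    (integrable_const _)]
  simp

lemma integrable_betaProd {f : ℝ × ℝ → ℝ} (hf : Continuous f) (x y : Action N) :
    Integrable (fun p => f (successProb p x, successProb p y)) (betaProd α β) := by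
  have := isProbabilityMeasure_betaProd hα hβ
  obtain ⟨C, hC⟩ := (isCompact_Icc.prod isCompact_Icc).exists_bound_of_continuousOn
    (s := Set.Icc (0 : ℝ) 1 ×ˢ Set.Icc (0 : ℝ) 1) hf.continuousOn
  refine Integrable.of_bound
    (hf.measurable.comp (by fun_prop : Measurable fun p : Param N =>
      (successProb p x, successProb p y))).aestronglyMeasurable C ?_
  filter_upwards [ae_betaProd_mem_Ioo hα hβ] with p hp
  exact hC _ ⟨⟨(hp x).1.le, (hp x).2.le⟩, ⟨(hp y).1.le, (hp y).2.le⟩⟩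

/-- The mean reward is bilinear in two independent parameters. Its deviation splits into one
centered term per parameter, each with a multiplier of modulus at most 1 (`hdec`). The cross term
integrates to 0 by independence, so the two variances add. -/
lemma integral_meanReward_sub_sq_betaProd_le (i : Fin N) :
    ∫ p, (meanReward p (.inl i) - ∫ p, meanReward p (.inl i) ∂betaProd α β) ^ 2 ∂betaProd α β
      ≤ 1 / (4 * (α (.inl i) + β (.inl i) + 1)) + 1 / (4 * (α (.inr i) + β (.inr i) + 1)) := by
  have := isProbabilityMeasure_betaProd hα hβ
  have hx := isProbabilityMeasureBeta (hα (.inl i)) (hβ (.inl i))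
  have hy := isProbabilityMeasureBeta (hα (.inr i)) (hβ (.inr i))
  have hne : (Sum.inl i : Action N) ≠ Sum.inr i := by simp
  set s := ∫ r, r ∂betaMeasure (α (.inl i)) (β (.inl i)) with hs
  set r := ∫ r, r ∂betaMeasure (α (.inr i)) (β (.inr i)) with hr
  have hs01 : |2 * s - 1| ≤ 1 := by
    have ha := hα (.inl i)
    have hb := hβ (.inl i)
    rw [hs, integral_id_betaMeasure ha hb]
    have h1 : α (.inl i) / (α (.inl i) + β (.inl i)) ≤ 1 := (div_le_one (by positivity)).2 (by linarith)
    have h0 : 0 ≤ α (.inl i) / (α (.inl i) + β (.inl i)) := by positivity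
    rw [abs_le]; constructor <;> linarith
  have hdec : ∀ p : Param N, meanReward p (.inl i) - (s * r + (1 - s) * (1 - r))
      = (successProb p (.inl i) - s) * (2 * successProb p (.inr i) - 1)
        + (2 * s - 1) * (successProb p (.inr i) - r) := by
    intro p; rw [meanReward_inl]; ring
  have hG : ∫ p, meanReward p (.inl i) ∂betaProd α β = s * r + (1 - s) * (1 - r) := by
    have h : ∫ p, (meanReward p (.inl i) - (s * r + (1 - s) * (1 - r))) ∂betaProd α β = 0 := by
      simp_rw [hdec]
      rw [integral_add
        (integrable_betaProd hα hβ (f := fun z => (z.1 - s) * (2 * z.2 - 1)) (by fun_prop) _ _)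
        (integrable_betaProd hα hβ (f := fun z => (2 * s - 1) * (z.2 - r)) (by fun_prop)
          (.inl i) (.inr i)),
        integral_sub_mean_betaProd_mul hα hβ (g := fun t => 2 * t - 1) (by fun_prop) hne,
        integral_const_mul]
      have := integral_sub_mean_betaProd_mul hα hβ (g := fun t => 1) (by fun_prop) hne.symm
      simp only [mul_one] at this
      rw [this]; ring
    rw [integral_sub (integrable_meanReward (ae_betaProd_mem_Ioo hα hβ) _) (integrable_const _)]
      at h
    simp at h
    linarith
  rw [hG]
  set c := 2 * (2 * s - 1) with hc
  have i1 := integrable_betaProd hα hβ (f := fun z => (z.1 - s) ^ 2) (by fun_prop)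
    (.inl i) (.inr i)
  have i2 := integrable_betaProd hα hβ (f := fun z => (z.2 - r) ^ 2) (by fun_prop)
    (.inl i) (.inr i)
  have i3 := integrable_betaProd hα hβ
    (f := fun z => (z.1 - s) * (c * (2 * z.2 - 1) * (z.2 - r))) (by fun_prop) (.inl i) (.inr i)
  dsimp only at i1 i2 i3
  have i12 : Integrable (fun p => (successProb p (.inl i) - s) ^ 2 + (successProb p (.inr i) - r) ^ 2)
      (betaProd α β) := i1.add i2
  have hle : ∫ p, (meanReward p (.inl i) - (s * r + (1 - s) * (1 - r))) ^ 2 ∂betaProd α β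
      ≤ ∫ p, ((successProb p (.inl i) - s) ^ 2 + (successProb p (.inr i) - r) ^ 2
        + (successProb p (.inl i) - s) *
          (c * (2 * successProb p (.inr i) - 1) * (successProb p (.inr i) - r))) ∂betaProd α β := by
    refine integral_mono_of_nonneg (ae_of_all _ fun p => sq_nonneg _) (i12.add i3) ?_
    filter_upwards [ae_betaProd_mem_Ioo hα hβ] with p hp
    rw [hdec, hc]
    have h1 : (2 * successProb p (.inr i) - 1) ^ 2 ≤ 1 := by
      rw [sq_le_one_iff_abs_le_one, abs_le]
      constructor <;> linarith [(hp (.inr i)).1, (hp (.inr i)).2]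
    have h2 : (2 * s - 1) ^ 2 ≤ 1 := (sq_le_one_iff_abs_le_one _).2 hs01
    have h3 := mul_le_mul_of_nonneg_left h1 (sq_nonneg (successProb p (.inl i) - s))
    have h4 := mul_le_mul_of_nonneg_left h2 (sq_nonneg (successProb p (.inr i) - r))
    linarith
  refine hle.trans ?_
  rw [integral_add i12 i3, integral_add i1 i2,
    integral_sub_mean_betaProd_mul hα hβ (g := fun t => c * (2 * t - 1) * (t - r)) (by fun_prop) hne,
    integral_betaProd_comp hα hβ (f := fun t => (t - s) ^ 2) (by fun_prop),
    integral_betaProd_comp hα hβ (f := fun t => (t - r) ^ 2) (by fun_prop), add_zero]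
  exact add_le_add (integral_sub_mean_sq_betaMeasure_le (hα _) (hβ _))
    (integral_sub_mean_sq_betaMeasure_le (hα _) (hβ _))

/-- The greedy action loses little in expectation, compared with the optimal reward. -/
lemma integral_optReward_betaProd_le [Nonempty (Action N)] {n D : ℝ} (hn : 0 < n)
    (hle : ∀ x, n ≤ α x + β x) (hD : 0 < D)
    (hD2 : (Fintype.card (Action N) : ℝ) / (4 * (n + 1)) ≤ D ^ 2) {g : Action N}
    (hg : ∀ x, ∫ p, meanReward p x ∂betaProd α β ≤ ∫ p, meanReward p g ∂betaProd α β) :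
    ∫ p, optReward p ∂betaProd α β - ∫ p, meanReward p g ∂betaProd α β ≤ D := by
  have := isProbabilityMeasure_betaProd hα hβ
  have hae := ae_betaProd_mem_Ioo hα hβ
  set G := fun x => ∫ p, meanReward p x ∂betaProd α β with hG
  have hint : ∀ i : Fin N, Integrable (fun p => (meanReward p (.inl i) - G (.inl i)) ^ 2)
      (betaProd α β) := by
    intro i
    refine Integrable.of_bound (by fun_prop) 4 ?_
    filter_upwards [hae] with p hp
    have h1 := abs_sub (meanReward p (.inl i)) (G (.inl i))
    have h2 := abs_meanReward_le hp (.inl i)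
    have h3 : |G (.inl i)| ≤ 1 := abs_integral_meanReward_le hae (.inl i)
    have h4 : |meanReward p (.inl i) - G (.inl i)| ≤ 2 := by linarith
    rw [Real.norm_eq_abs, abs_pow]
    nlinarith [abs_nonneg (meanReward p (.inl i) - G (.inl i))]
  have hsum := integrable_finsetSum Finset.univ fun i (_ : i ∈ Finset.univ) => hint i
  -- For each arm, `y ≤ D/2 + y²/(2D)` with `y` the deviation from the posterior mean. Bounding its
  -- square by the sum over all arms makes the right side uniform in the arm, so the maximum can be
  -- integrated.
  have hpt : ∀ p : Param N, optReward p
      ≤ (G g + D / 2) + (∑ i, (meanReward p (.inl i) - G (.inl i)) ^ 2) * (1 / (2 * D)) := by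
    intro p
    have hs : 0 ≤ ∑ i, (meanReward p (.inl i) - G (.inl i)) ^ 2 :=
      Finset.sum_nonneg fun i _ => sq_nonneg _
    refine ciSup_le fun x => ?_
    cases x with
    | inl i =>
      have h1 : (meanReward p (.inl i) - G (.inl i)) ^ 2
          ≤ ∑ i, (meanReward p (.inl i) - G (.inl i)) ^ 2 :=
        Finset.single_le_sum (f := fun i => (meanReward p (.inl i) - G (.inl i)) ^ 2)
          (fun i _ => sq_nonneg _) (Finset.mem_univ i)
      have h2 := mul_le_mul_of_nonneg_right h1 (show 0 ≤ 1 / (2 * D) by positivity)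
      have h3 : D / 2 + (meanReward p (.inl i) - G (.inl i)) ^ 2 * (1 / (2 * D))
          - (meanReward p (.inl i) - G (.inl i))
          = (meanReward p (.inl i) - G (.inl i) - D) ^ 2 * (1 / (2 * D)) := by
        field_simp; ring
      have h4 : 0 ≤ (meanReward p (.inl i) - G (.inl i) - D) ^ 2 * (1 / (2 * D)) := by positivity
      have h5 : G (.inl i) ≤ G g := hg _
      linarith
    | inr i =>
      rw [meanReward_inr]
      have h5 : -1 ≤ G g := (abs_le.1 (abs_integral_meanReward_le hae g)).1
      have h6 : 0 ≤ (∑ i, (meanReward p (.inl i) - G (.inl i)) ^ 2) * (1 / (2 * D)) := by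
        positivity
      linarith
  have hmain := integral_mono (integrable_optReward hae)
    ((integrable_const _).add (hsum.mul_const _)) hpt
  simp only [Pi.add_apply] at hmain
  rw [integral_add (integrable_const _) (hsum.mul_const _), integral_mul_const,
    integral_finsetSum _ fun i _ => hint i] at hmain
  have hV : ∑ i, ∫ p, (meanReward p (.inl i) - G (.inl i)) ^ 2 ∂betaProd α β ≤ D ^ 2 := by
    refine le_trans ?_ hD2
    calc _ ≤ ∑ i : Fin N, (1 / (4 * (n + 1)) + 1 / (4 * (n + 1))) := by
          refine Finset.sum_le_sum fun i _ =>
            (integral_meanReward_sub_sq_betaProd_le hα hβ i).trans ?_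
          have h1 := hle (.inl i)
          have h2 := hle (.inr i)
          gcongr
      -- Two variances for each of `N` arms: the factor `2N` is exactly the number of actions.
      _ = _ := by simp [Fintype.card_sum]; field_simp
  have hV' := mul_le_mul_of_nonneg_right hV (show 0 ≤ 1 / (2 * D) by positivity)
  have : D ^ 2 * (1 / (2 * D)) = D / 2 := by field_simp
  simp at hmain
  simp only [one_div, mul_inv_rev] at hV' this
  linarith

end betaProd

/-! ### The comparison policy and its information ratio. -/

/-- The policy that plays `x` with probability `ε` and `g` otherwise. -/
noncomputable def mixPolicy (g x : Action N) (ε : ℝ) (h0 : 0 ≤ ε) (h1 : ε ≤ 1) : PMF (Action N) :=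
  PMF.ofFintype
    (fun a => ENNReal.ofReal ((if a = g then 1 - ε else 0) + if a = x then ε else 0)) <| by
    rw [← ENNReal.ofReal_sum_of_nonneg, Finset.sum_add_distrib]
    · simp
    · intro a _
      have := sub_nonneg.2 h1
      positivity

lemma toReal_mixPolicy (g x : Action N) {ε : ℝ} (h0 : 0 ≤ ε) (h1 : ε ≤ 1) (a : Action N) :
    (mixPolicy g x ε h0 h1 a).toReal = (if a = g then 1 - ε else 0) + if a = x then ε else 0 := by
  have := sub_nonneg.2 h1
  rw [mixPolicy, PMF.ofFintype_apply, ENNReal.toReal_ofReal (by positivity)]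

/-- An inequality, because `g = x` is allowed and then the two masses add. -/
lemma ofReal_le_mixPolicy (g x : Action N) {ε : ℝ} (h0 : 0 ≤ ε) (h1 : ε ≤ 1) :
    ENNReal.ofReal ε ≤ mixPolicy g x ε h0 h1 x := by
  have := sub_nonneg.2 h1
  rw [mixPolicy, PMF.ofFintype_apply]
  refine ENNReal.ofReal_le_ofReal ?_
  simp only [if_true]
  split_ifs <;> linarith

lemma le_mutualInfo_stepLaw_betaProd {α β : Action N → ℝ} (hα : ∀ x, 1 ≤ α x) (hβ : ∀ x, 1 ≤ β x)
    (ν : PMF (Action N)) (x : Action N) :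
    ν x * ENNReal.ofReal (1 / (6 * (α x + β x - 1))) ≤ mutualInfo (stepLaw (betaProd α β) ν) := by
  have hα0 := fun x => one_pos.trans_le (hα x)
  have hβ0 := fun x => one_pos.trans_le (hβ x)
  have := isProbabilityMeasure_betaProd hα0 hβ0
  have hb := isProbabilityMeasureBeta (hα0 x) (hβ0 x)
  have hpos : 0 < α x + β x := add_pos (hα0 x) (hβ0 x)
  refine le_trans ?_ (le_mutualInfo_stepLaw (ae_betaProd_mem_Ioo hα0 hβ0) ν x)
  gcongr
  have htrue : ∫ p, obsProb p x true ∂betaProd α β = α x / (α x + β x) := by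
    simp only [obsProb, if_true]
    rw [integral_betaProd_comp hα0 hβ0 (f := fun r => r) (by fun_prop),
      integral_id_betaMeasure (hα0 x) (hβ0 x)]
  have hfalse : ∫ p, obsProb p x false ∂betaProd α β = β x / (α x + β x) := by
    simp only [obsProb, Bool.false_eq_true, if_false]
    rw [integral_betaProd_comp hα0 hβ0 (f := fun r => 1 - r) (by fun_prop),
      integral_sub (integrable_const _)
        (integrable_betaMeasure (hα0 x) (hβ0 x) (f := fun r => r) (by fun_prop)),
      integral_id_betaMeasure (hα0 x) (hβ0 x)]
    simp
    field_simp
    ring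
  have hk := InformationTheory.measurable_klFun
  rw [Fintype.sum_bool, htrue, hfalse]
  simp only [obsProb, if_true, Bool.false_eq_true, if_false]
  have hmap : ∀ f : ℝ → ℝ≥0∞, Measurable f → ∫⁻ p, f (successProb p x) ∂betaProd α β
      = ∫⁻ r, f r ∂betaMeasure (α x) (β x) := by
    intro f hf
    rw [← betaProd_map_successProb hα0 hβ0 x, lintegral_map hf (by fun_prop)]
  rw [hmap (fun r => ENNReal.ofReal (InformationTheory.klFun (r / (α x / (α x + β x)))))
      (by fun_prop),
    hmap (fun r => ENNReal.ofReal (InformationTheory.klFun ((1 - r) / (β x / (α x + β x)))))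
      (by fun_prop)]
  exact le_betaMeasure_info (hα x) (hβ x)

/-- Under independent beta laws, mixing the greedy action with the least explored one yields a
small information ratio. -/
lemma exists_infoRatio_betaProd_le [Nonempty (Action N)] {α β : Action N → ℝ}
    (hα : ∀ x, 1 ≤ α x) (hβ : ∀ x, 1 ≤ β x) :
    ∃ ν : PMF (Action N), infoRatio (stepLaw (betaProd α β) ν) ≤ ENNReal.ofReal
      (24 * √(∑ x, (α x + β x) - Fintype.card (Action N))) := by
  have hα0 := fun x => one_pos.trans_le (hα x)
  have hβ0 := fun x => one_pos.trans_le (hβ x)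
  have := isProbabilityMeasure_betaProd hα0 hβ0
  have hae := ae_betaProd_mem_Ioo hα0 hβ0
  obtain ⟨x, hx⟩ := Finite.exists_min fun x => α x + β x
  obtain ⟨g, hg⟩ := Finite.exists_max fun a => ∫ p, meanReward p a ∂betaProd α β
  set n := α x + β x with hn
  have hn2 : 2 ≤ n := by linarith [hα x, hβ x]
  have hn1 : 0 < n - 1 := by linarith
  set K : ℝ := (Fintype.card (Action N) : ℝ) with hK
  have hK0 : 0 < K := by rw [hK]; exact_mod_cast Fintype.card_pos
  set D := √(K / (4 * (n + 1))) with hD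
  have hD0 : 0 < D := by positivity
  have hDsq : D ^ 2 = K / (4 * (n + 1)) := Real.sq_sqrt (by positivity)
  have hΔ := integral_optReward_betaProd_le hα0 hβ0 (by linarith) hx hD0 hDsq.ge hg
  set S := √(∑ x, (α x + β x) - K) with hS
  have hsum : K * (n - 1) ≤ ∑ x, (α x + β x) - K := by
    have := Finset.card_nsmul_le_sum Finset.univ (fun x => α x + β x) n fun x _ => hx x
    rw [nsmul_eq_mul, Finset.card_univ, ← hK] at this
    linarith
  -- The trade-off between regret and information: `(2D(n-1))² = K(n-1)·(n-1)/(n+1) ≤ K(n-1) ≤ S²`,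
  -- by minimality of `n`.
  have hDS : 2 * D * (n - 1) ≤ S := by
    refine Real.le_sqrt_of_sq_le (le_trans ?_ hsum)
    rw [mul_pow, mul_pow, hDsq]
    have : 2 ^ 2 * (K / (4 * (n + 1))) * (n - 1) ^ 2 = K * (n - 1) * ((n - 1) / (n + 1)) := by
      field_simp; ring
    rw [this]
    refine mul_le_of_le_one_right (by positivity) ((div_le_one (by linarith)).2 (by linarith))
  have hr0 := integral_meanReward_le_integral_optReward hae
  have hr2 : ∀ a, ∫ p, optReward p ∂betaProd α β - ∫ p, meanReward p a ∂betaProd α β ≤ 2 := by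
    intro a
    linarith [(abs_le.1 (abs_integral_optReward_le hae)).2,
      (abs_le.1 (abs_integral_meanReward_le hae a)).1]
  -- With `ε = D/2` both regret contributions are at most `D`, and `(2D)²·6(n-1) ≤ 12 D S = 24 S ε`
  -- by `hDS`. If `D > 2` this is not a probability; pure exploration then suffices, as its regret
  -- is at most 2 and `hDS` gives `n - 1 ≤ S`.
  obtain ⟨ε, hε0, hε1, hreg⟩ : ∃ ε : ℝ, 0 < ε ∧ ε ≤ 1 ∧ ((1 - ε) * D + ε * 2) ^ 2 * (6 * (n - 1))
      ≤ 24 * S * ε := by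
    rcases le_or_gt D 2 with h | h
    · refine ⟨D / 2, by positivity, by linarith, ?_⟩
      have h1 : ((1 - D / 2) * D + D / 2 * 2) ^ 2 ≤ (2 * D) ^ 2 := by
        refine pow_le_pow_left₀ ?_ ?_ 2
        · nlinarith
        · nlinarith
      have h2 := mul_le_mul_of_nonneg_right h1 (show 0 ≤ 6 * (n - 1) by linarith)
      have h3 := mul_le_mul_of_nonneg_left hDS (show 0 ≤ 12 * D by positivity)
      linarith
    · refine ⟨1, one_pos, le_rfl, ?_⟩
      have h3 := mul_le_mul_of_nonneg_right h.le hn1.le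
      linarith
  refine ⟨mixPolicy g x ε hε0.le hε1, ?_⟩
  rw [infoRatio, integral_regret_stepLaw hae]
  simp only [toReal_mixPolicy, add_mul, ite_mul, zero_mul, Finset.sum_add_distrib,
    Finset.sum_ite_eq', Finset.mem_univ, if_true]
  have hI := (mul_le_mul_left (ofReal_le_mixPolicy g x hε0.le hε1)
    (ENNReal.ofReal (1 / (6 * (n - 1))))).trans
    (le_mutualInfo_stepLaw_betaProd hα hβ (mixPolicy g x ε hε0.le hε1) x)
  rw [← ENNReal.ofReal_mul hε0.le] at hI
  refine (ENNReal.div_le_div_left hI _).trans ?_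
  have hIpos : 0 < ε * (1 / (6 * (n - 1))) := by positivity
  rw [← ENNReal.ofReal_div_of_pos hIpos]
  refine ENNReal.ofReal_le_ofReal ?_
  rw [div_le_iff₀ hIpos, mul_one_div, mul_div_assoc', le_div_iff₀ (by positivity)]
  refine le_trans (mul_le_mul_of_nonneg_right (pow_le_pow_left₀ ?_ ?_ 2) (by positivity)) hreg
  · have h1 := mul_nonneg (sub_nonneg.2 hε1) (sub_nonneg.2 (hr0 g))
    have h2 := mul_nonneg hε0.le (sub_nonneg.2 (hr0 x))
    linarith
  · have h1 := mul_le_mul_of_nonneg_left hΔ (sub_nonneg.2 hε1)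
    have h2 := mul_le_mul_of_nonneg_left (hr2 x) hε0.le
    linarith

/-! ### From one step to the cumulative bound. -/

lemma IsInteraction.ae_condInfoRatio_le [Nonempty (Action N)] {Ω : Type*} [MeasurableSpace Ω]
    {P : Measure Ω} [IsProbabilityMeasure P] {ψ : Ω → Param N} {A : ℕ → Ω → Action N}
    {O : ℕ → Ω → Obs} {π : Agent N} (hrun : IsInteraction P ψ A O π)
    (hids : IsIDS P ψ A O π) (t : ℕ) :
    ∀ᵐ ω ∂P, condInfoRatio P ψ A O t ω
      ≤ ENNReal.ofReal (24 * √(t + Fintype.card (Action N))) := by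
  -- There are finitely many histories of length `t`, so almost surely the realized one has positive
  -- probability, where the interaction and IDS conditions apply.
  have hae : ∀ᵐ ω ∂P, P (hist A O t ⁻¹' {hist A O t ω}) ≠ 0 := by
    have h : ∀ᵐ ω ∂P, ∀ h : History N t, P (hist A O t ⁻¹' {h}) = 0 → hist A O t ω ≠ h := by
      refine ae_all_iff.2 fun h => ?_
      by_cases hz : P (hist A O t ⁻¹' {h}) = 0
      · have : ∀ᵐ ω ∂P, ω ∉ hist A O t ⁻¹' {h} := measure_eq_zero_iff_ae_notMem.1 hz
        exact this.mono fun ω hω _ => hω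
      · exact ae_of_all _ fun ω hc => absurd hc hz
    exact h.mono fun ω hω hz => hω _ hz rfl
  refine hae.mono fun ω hω => ?_
  obtain ⟨a, b, ha, hb, hab, hpost⟩ := hrun.exists_posterior_eq t _ hω
  obtain ⟨ν, hν⟩ := exists_infoRatio_betaProd_le ha hb
  rw [condInfoRatio, hrun.law_step t _ hω]
  refine (hids t _ hω ν).trans ?_
  rw [hpost]
  refine hν.trans (le_of_eq ?_)
  rw [hab]
  congr 3
  ring

end BanditAlignment

theorem mainTheorem5 {N : ℕ} (hN : 0 < N) {Ω : Type*} [MeasurableSpace Ω]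
    (P : Measure Ω) [IsProbabilityMeasure P]
    (ψ : Ω → BanditAlignment.Param N) (A : ℕ → Ω → BanditAlignment.Action N)
    (O : ℕ → Ω → BanditAlignment.Obs) (π : BanditAlignment.Agent N)
    (hrun : BanditAlignment.IsInteraction P ψ A O π)
    (hids : BanditAlignment.IsIDS P ψ A O π) (T : ℕ) :
    ∑ t ∈ Finset.range T, ∫⁻ ω, BanditAlignment.condInfoRatio P ψ A O t ω ∂P ≤
      ENNReal.ofReal
        (33 * √((Fintype.card (BanditAlignment.Action N) : ℝ) * (T : ℝ) ^ 3)) := by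
  have : Nonempty (BanditAlignment.Action N) := ⟨.inl ⟨0, hN⟩⟩
  rcases Nat.eq_zero_or_pos T with rfl | hT
  · simp
  have hT1 : (1 : ℝ) ≤ T := by exact_mod_cast hT
  set K : ℝ := (Fintype.card (BanditAlignment.Action N) : ℝ) with hK
  have hK2 : 2 ≤ K := by
    have : (1 : ℝ) ≤ N := by exact_mod_cast hN
    rw [hK, Fintype.card_sum, Fintype.card_fin]
    push_cast
    linarith
  have hstep : ∀ t ∈ Finset.range T, ∫⁻ ω, BanditAlignment.condInfoRatio P ψ A O t ω ∂P
      ≤ ENNReal.ofReal (24 * √(T + K)) := by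
    intro t ht
    have h1 := lintegral_mono_ae (hrun.ae_condInfoRatio_le hids t)
    rw [lintegral_const, measure_univ, mul_one] at h1
    have h2 : (t : ℝ) ≤ T := by exact_mod_cast (Finset.mem_range.1 ht).le
    exact h1.trans (ENNReal.ofReal_le_ofReal (by rw [← hK]; gcongr))
  refine (Finset.sum_le_card_nsmul _ _ _ hstep).trans ?_
  rw [Finset.card_range, nsmul_eq_mul, ← ENNReal.ofReal_natCast, ← ENNReal.ofReal_mul (by positivity)]
  refine ENNReal.ofReal_le_ofReal ((pow_le_pow_iff_left₀ (by positivity) (by positivity) two_ne_zero).1 ?_)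
  rw [mul_pow, mul_pow, mul_pow, Real.sq_sqrt (by positivity), Real.sq_sqrt (by positivity)]
  -- From `(K - 1)(T - 1) ≥ 0` and `K T ≥ 2`. The constant 33 then comes from `24² · 3/2 = 864 ≤
  -- 33²`.
  have h1 : T + K ≤ 3 / 2 * (K * T) := by nlinarith
  have h2 := mul_le_mul_of_nonneg_left h1 (show (0 : ℝ) ≤ T ^ 2 * 24 ^ 2 by positivity)
  have h3 : 0 ≤ K * (T : ℝ) ^ 3 := by positivity
  nlinarith
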